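/- Let formulas be built from a countably infinite set of propositional letters $x_0,x_1,x_2,\dots$ by the Boolean connectives and a binary operation $S$ ("since"). For a valuation $V$ (assigning to each letter a set of natural numbers), truth of a formula at a state $a\in\mathbb N$ is defined in the usual way for letters and Boolean connectives, and $$a\models_V \varphi\,S\,\psi \iff \exists b\ge a\ \bigl[\,b\models_V\psi \ \text{ and }\ c\models_V\varphi \text{ for all } c \text{ with } a\le c<b\,\bigr],$$ where $\le$ is the usual order of $\mathbb N$; the states at or before $a$ in time are the numbers $b\ge a$, that is, time runs along $\mathbb N$ with the order reversed. The logic $LTL_S^-$ is the set of all formulas true at every state under every valuation. Put $\Diamond^-\varphi:=\top\,S\,\varphi$ and $\Box^-\varphi:=\neg\Diamond^-\neg\varphi$. A substitution $\sigma$ of formulas for letters is a *unifier* of $\varphi$ if $\sigma(\varphi)\in LTL_S^-$, and $\varphi$ is *unifiable* if it has a unifier. A *projective unifier* of $\varphi$ is a unifier $\sigma$ of $\varphi$ such that $\Box^-\varphi\to(x\equiv\sigma(x))\in LTL_S^-$ for every letter $x$ of $\varphi$; and $\varphi$ is *projective* if it has a projective unifier. **Theorem.** Every formula that is unifiable in $LTL_S^-$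 is projective in $LTL_S^-$. Moreover, a projective unifier can be computed: there is a computable function that assigns to each formula $\varphi$ a finite list of pairs (letter, formula) such that, whenever $\varphi$ is unifiable, the substitution given by this list (leaving all other letters unchanged) is a projective unifier of $\varphi$. -/

import Mathlib

namespace PastLTL

/-- Formulas of the past linear temporal logic with "since" over the propositional letters
`x₀, x₁, x₂, …`. The other Boolean connectives are defined below. -/
inductive Formula : Type
  | bot : Formula
  | var : ℕ → Formula
  | neg : Formula → Formula
  | conj : Formula → Formula → Formula
  | since : Formula → Formula → Formula
  deriving DecidableEq

namespace Formula

/-- `⊤`. -/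
def top : Formula := neg bot

/-- `φ → ψ`. -/
def imp (φ ψ : Formula) : Formula := neg (conj φ (neg ψ))

/-- `φ ≡ ψ`. -/
def iff (φ ψ : Formula) : Formula := conj (imp φ ψ) (imp ψ φ)

/-- `◇⁻ φ := ⊤ S φ`. -/
def diamond (φ : Formula) : Formula := since top φ

/-- `□⁻ φ := ¬ ◇⁻ ¬ φ`. -/
def box (φ : Formula) : Formula := neg (diamond (neg φ))

/-- The propositional letters that occur in a formula. -/
def letters : Formula → Finset ℕ
  | bot => ∅
  | var n => {n}
  | neg φ => letters φ
  | conj φ ψ => letters φ ∪ letters ψ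
  | since φ ψ => letters φ ∪ letters ψ

/-- Truth at a state `a` of the frame `⟨ℕ, ≥⟩` under the valuation `V`. The order of time is the
reverse of the usual order of `ℕ`: the states at or before `a` in time are the numbers `b ≥ a`,
and `<`, `≤` below are the usual orders of `ℕ`. -/
def Sat (V : ℕ → Set ℕ) : ℕ → Formula → Prop
  | _, bot => False
  | a, var n => a ∈ V n
  | a, neg φ => ¬ Sat V a φ
  | a, conj φ ψ => Sat V a φ ∧ Sat V a ψ
  | a, since φ ψ => ∃ b, b ≥ a ∧ Sat V b ψ ∧ ∀ c, a ≤ c ∧ c < b → Sat V c φ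

/-- The result of applying a substitution to a formula. -/
def subst (σ : ℕ → Formula) : Formula → Formula
  | bot => bot
  | var n => σ n
  | neg φ => neg (subst σ φ)
  | conj φ ψ => conj (subst σ φ) (subst σ ψ)
  | since φ ψ => since (subst σ φ) (subst σ ψ)

/-- The standard Gödel numbering of formulas by means of the pairing function of `ℕ`. -/
def encodeNat : Formula → ℕ
  | bot => 0
  | var n => 4 * n + 1
  | neg φ => 4 * encodeNat φ + 2
  | conj φ ψ => 4 * Nat.pair (encodeNat φ) (encodeNat ψ) + 3
  | since φ ψ => 4 * Nat.pair (encodeNat φ) (encodeNat ψ) + 4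

/-- The formula with a given Gödel number. -/
def decodeNat : ℕ → Formula
  | 0 => bot
  | k + 1 =>
    have h : k / 4 < k + 1 := by omega
    have h₁ : (k / 4).unpair.1 < k + 1 := lt_of_le_of_lt (Nat.unpair_left_le _) h
    have h₂ : (k / 4).unpair.2 < k + 1 := lt_of_le_of_lt (Nat.unpair_right_le _) h
    match k % 4 with
    | 0 => var (k / 4)
    | 1 => neg (decodeNat (k / 4))
    | 2 => conj (decodeNat (k / 4).unpair.1) (decodeNat (k / 4).unpair.2)
    | _ => since (decodeNat (k / 4).unpair.1) (decodeNat (k / 4).unpair.2)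

theorem decodeNat_encodeNat (φ : Formula) : decodeNat (encodeNat φ) = φ := by
  induction φ with
  | bot => simp [encodeNat, decodeNat]
  | var n =>
    rw [encodeNat, decodeNat]
    simp
  | neg φ ih =>
    have h : (4 * encodeNat φ + 1) / 4 = encodeNat φ := by omega
    have h' : (4 * encodeNat φ + 1) % 4 = 1 := by omega
    rw [encodeNat, decodeNat, h, h']
    simp [ih]
  | conj φ ψ ih₁ ih₂ =>
    have h : (4 * Nat.pair (encodeNat φ) (encodeNat ψ) + 2) / 4
      = Nat.pair (encodeNat φ) (encodeNat ψ) := by omega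
    have h' : (4 * Nat.pair (encodeNat φ) (encodeNat ψ) + 2) % 4 = 2 := by omega
    rw [encodeNat, decodeNat, h, h']
    simp [ih₁, ih₂]
  | since φ ψ ih₁ ih₂ =>
    have h : (4 * Nat.pair (encodeNat φ) (encodeNat ψ) + 3) / 4
      = Nat.pair (encodeNat φ) (encodeNat ψ) := by omega
    have h' : (4 * Nat.pair (encodeNat φ) (encodeNat ψ) + 3) % 4 = 3 := by omega
    rw [encodeNat, decodeNat, h, h']
    simp [ih₁, ih₂]

theorem encodeNat_decodeNat (n : ℕ) : encodeNat (decodeNat n) = n := by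
  induction n using Nat.strong_induction_on with
  | _ n ih =>
    match n with
    | 0 => simp [decodeNat, encodeNat]
    | k + 1 =>
      have h : k / 4 < k + 1 := by omega
      have h₁ := ih _ (lt_of_le_of_lt (Nat.unpair_left_le (k / 4)) h)
      have h₂ := ih _ (lt_of_le_of_lt (Nat.unpair_right_le (k / 4)) h)
      have h₀ := ih _ h
      rw [decodeNat]
      have hk : k % 4 = 0 ∨ k % 4 = 1 ∨ k % 4 = 2 ∨ k % 4 = 3 := by omega
      rcases hk with hk | hk | hk | hk <;> simp only [hk, encodeNat, h₀, h₁, h₂, Nat.pair_unpair]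
        <;> omega

/-- Formulas are identified with their Gödel numbers; this fixes what a computable function of
formulas is. -/
instance : Denumerable Formula :=
  Denumerable.mk' ⟨encodeNat, decodeNat, decodeNat_encodeNat, encodeNat_decodeNat⟩

end Formula

/-- The logic `LTL_S⁻`: the set of all formulas that are true at every state under every
valuation. -/
def Logic : Set Formula := {φ | ∀ (V : ℕ → Set ℕ) (a : ℕ), φ.Sat V a}

/-- A substitution `σ` is a unifier of `φ`. -/
def IsUnifier (φ : Formula) (σ : ℕ → Formula) : Prop := φ.subst σ ∈ Logic

/-- `φ` is unifiable in `LTL_S⁻`. -/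
def Unifiable (φ : Formula) : Prop := ∃ σ : ℕ → Formula, IsUnifier φ σ

/-- A substitution `σ` is a projective unifier of `φ`: it is a unifier of `φ`, and
`□⁻ φ → (x ≡ σ(x))` belongs to the logic for each letter `x` of `φ`. -/
def IsProjectiveUnifier (φ : Formula) (σ : ℕ → Formula) : Prop :=
  IsUnifier φ σ ∧
    ∀ x ∈ φ.letters, Formula.imp φ.box (Formula.iff (Formula.var x) (σ x)) ∈ Logic

/-- `φ` is projective in `LTL_S⁻`. -/
def Projective (φ : Formula) : Prop := ∃ σ : ℕ → Formula, IsProjectiveUnifier φ σ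

/-- The substitution given by a finite table of pairs (letter, formula). The first entry for a
letter counts, and letters without an entry are left unchanged. -/
def tableSubst (s : List (ℕ × Formula)) : ℕ → Formula :=
  fun x => (s.lookup x).getD (Formula.var x)

end PastLTL

/-!
Time runs so that the states relevant to a formula at `a` are the `b ≥ a`, and the only temporal
connective is the reflexive `S`. Two facts about this language carry the proof.

* *Stuttering* (`sat_succ_iff`): if `a` and `a + 1` satisfy the same letters of `φ`, then they agree
  on `φ`. In particular, along a valuation that is constant from `a` on, `φ S ψ` is equivalent
  to `ψ`, so that truth reduces to a Boolean evaluation (`constEval`).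
* Hence a unifiable formula `φ` is true under some *constant* assignment `v` of truth values to
  its letters (`Unifiable.exists_constEval`): apply the unifier and make all letters false.

Given such a `v`, the projective unifier `projSubst` is defined as follows. The states at which
`□⁻ φ` holds form a final segment of `ℕ`. If it is not empty, give each letter at `a` the value
that it has at the first state `b ≥ a` with `□⁻ φ`, as expressed by `(¬ □⁻ φ) S (□⁻ φ ∧ x)`;
if it is empty, give the letter the constant value `v x`. At states of the final segment nothing is
changed, so there `φ` stays true; before it the new valuation merely repeats the one at `b`, so
`φ` is true by stuttering; and if the segment is empty, `φ` is true by the choice of `v`.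

A suitable `v` is found by a bounded search through the lists of truth values for the letters below
the Gödel number of `φ`; the Boolean evaluation is primitive recursive by course-of-values
recursion on Gödel numbers. So the unifier is even a primitive recursive function of `φ`.
-/

namespace PastLTL

namespace Formula

/-! ### Semantics -/

theorem sat_imp {V : ℕ → Set ℕ} {a : ℕ} {φ ψ : Formula} :
    (imp φ ψ).Sat V a ↔ (φ.Sat V a → ψ.Sat V a) := by
  simp [imp, Sat]

theorem sat_iff {V : ℕ → Set ℕ} {a : ℕ} {φ ψ : Formula} :
    (iff φ ψ).Sat V a ↔ (φ.Sat V a ↔ ψ.Sat V a) := by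
  simp only [iff, Sat, sat_imp, iff_def]

theorem sat_diamond {V : ℕ → Set ℕ} {a : ℕ} {φ : Formula} :
    (diamond φ).Sat V a ↔ ∃ b ≥ a, φ.Sat V b := by
  simp [diamond, top, Sat]

theorem sat_box {V : ℕ → Set ℕ} {a : ℕ} {φ : Formula} :
    (box φ).Sat V a ↔ ∀ b ≥ a, φ.Sat V b := by
  simp [box, Sat, sat_diamond]

theorem sat_box_mono {V : ℕ → Set ℕ} {a b : ℕ} {φ : Formula} (hab : a ≤ b)
    (h : (box φ).Sat V a) : (box φ).Sat V b :=
  sat_box.2 fun c hc => sat_box.1 h c (hab.trans hc)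

theorem sat_since_iff_succ {V : ℕ → Set ℕ} {a : ℕ} {φ ψ : Formula} :
    (since φ ψ).Sat V a ↔ ψ.Sat V a ∨ φ.Sat V a ∧ (since φ ψ).Sat V (a + 1) := by
  simp only [Sat]
  constructor
  · rintro ⟨b, hb, hψ, hφ⟩
    rcases eq_or_lt_of_le hb with rfl | hlt
    · exact .inl hψ
    · exact .inr ⟨hφ a ⟨le_rfl, hlt⟩, b, hlt, hψ, fun c hc => hφ c ⟨by omega, hc.2⟩⟩
  · rintro (hψ | ⟨hφ, b, hb, hψ, h⟩)
    · exact ⟨a, le_rfl, hψ, fun c hc => by omega⟩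
    · refine ⟨b, by omega, hψ, fun c hc => ?_⟩
      rcases eq_or_lt_of_le hc.1 with rfl | hlt
      · exact hφ
      · exact h c ⟨hlt, hc.2⟩

theorem sat_subst (σ : ℕ → Formula) (V : ℕ → Set ℕ) (φ : Formula) (a : ℕ) :
    (φ.subst σ).Sat V a ↔ φ.Sat (fun n => {b | (σ n).Sat V b}) a := by
  induction φ generalizing a <;> simp_all [subst, Sat]

theorem sat_congr {V W : ℕ → Set ℕ} {φ : Formula} {a : ℕ}
    (h : ∀ n ∈ φ.letters, ∀ b ≥ a, (b ∈ V n ↔ b ∈ W n)) : φ.Sat V a ↔ φ.Sat W a := by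
  induction φ generalizing a with
  | bot => rfl
  | var n => exact h n (by simp [letters]) a le_rfl
  | neg φ ih => exact not_congr (ih h)
  | conj φ ψ ih₁ ih₂ =>
    simp only [letters, Finset.mem_union] at h
    exact and_congr (ih₁ fun n hn => h n (.inl hn)) (ih₂ fun n hn => h n (.inr hn))
  | since φ ψ ih₁ ih₂ =>
    simp only [letters, Finset.mem_union] at h
    simp only [Sat]
    refine exists_congr fun b => and_congr_right fun hb => and_congr ?_ ?_
    · exact ih₂ fun n hn c hc => h n (.inr hn) c (hb.trans hc)
    · exact forall_congr' fun c => imp_congr_right fun hc =>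
        ih₁ fun n hn d hd => h n (.inl hn) d (hc.1.trans hd)

/-- Stuttering invariance, which rests on the absence of a "previous state" operator. -/
theorem sat_succ_iff {V : ℕ → Set ℕ} {φ : Formula} {a : ℕ}
    (h : ∀ n ∈ φ.letters, (a ∈ V n ↔ a + 1 ∈ V n)) : φ.Sat V a ↔ φ.Sat V (a + 1) := by
  induction φ with
  | bot => rfl
  | var n => exact h n (by simp [letters])
  | neg φ ih => exact not_congr (ih h)
  | conj φ ψ ih₁ ih₂ =>
    simp only [letters, Finset.mem_union] at h
    exact and_congr (ih₁ fun n hn => h n (.inl hn)) (ih₂ fun n hn => h n (.inr hn))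
  | since φ ψ ih₁ ih₂ =>
    simp only [letters, Finset.mem_union] at h
    have h₁ := ih₁ fun n hn => h n (.inl hn)
    have h₂ := ih₂ fun n hn => h n (.inr hn)
    have h₃ := sat_since_iff_succ (V := V) (a := a + 1) (φ := φ) (ψ := ψ)
    rw [sat_since_iff_succ, h₁, h₂]
    tauto

/-! ### Constant valuations -/

/-- The truth value of a formula when each letter `n` has the value `v n` at all states. -/
def constEval (v : ℕ → Bool) : Formula → Bool
  | bot => false
  | var n => v n
  | neg φ => !constEval v φ
  | conj φ ψ => constEval v φ && constEval v ψ
  | since _ ψ => constEval v ψ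

theorem sat_iff_constEval {V : ℕ → Set ℕ} {v : ℕ → Bool} {φ : Formula} {a : ℕ}
    (h : ∀ n ∈ φ.letters, ∀ b ≥ a, (b ∈ V n ↔ v n = true)) :
    φ.Sat V a ↔ constEval v φ = true := by
  induction φ generalizing a with
  | bot => simp [Sat, constEval]
  | var n => exact h n (by simp [letters]) a le_rfl
  | neg φ ih => simp [Sat, constEval, ih h]
  | conj φ ψ ih₁ ih₂ =>
    simp only [letters, Finset.mem_union] at h
    simp [Sat, constEval, ih₁ fun n hn => h n (.inl hn), ih₂ fun n hn => h n (.inr hn)]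
  | since φ ψ ih₁ ih₂ =>
    simp only [letters, Finset.mem_union] at h
    have hψ : ∀ b ≥ a, (ψ.Sat V b ↔ constEval v ψ = true) := fun b hb =>
      ih₂ fun n hn c hc => h n (.inr hn) c (hb.trans hc)
    simp only [Sat, constEval]
    constructor
    · rintro ⟨b, hb, hs, -⟩
      exact (hψ b hb).1 hs
    · intro hs
      exact ⟨a, le_rfl, (hψ a le_rfl).2 hs, fun c hc => by omega⟩

theorem constEval_congr {v w : ℕ → Bool} {φ : Formula} (h : ∀ n ∈ φ.letters, v n = w n) :
    constEval v φ = constEval w φ := by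
  induction φ with
  | bot => rfl
  | var n => exact h n (by simp [letters])
  | neg φ ih => simp [constEval, ih h]
  | conj φ ψ ih₁ ih₂ =>
    simp only [letters, Finset.mem_union] at h
    simp [constEval, ih₁ fun n hn => h n (.inl hn), ih₂ fun n hn => h n (.inr hn)]
  | since φ ψ ih₁ ih₂ =>
    simp only [letters, Finset.mem_union] at h
    exact ih₂ fun n hn => h n (.inr hn)

end Formula

open Formula

theorem Unifiable.exists_constEval {φ : Formula} (h : Unifiable φ) :
    ∃ v : ℕ → Bool, constEval v φ = true := by
  obtain ⟨τ, hτ⟩ := h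
  refine ⟨fun n => constEval (fun _ => false) (τ n), ?_⟩
  have h₀ := (sat_subst τ (fun _ => ∅) φ 0).1 (hτ _ 0)
  refine (sat_iff_constEval fun n _ b _ => ?_).1 h₀
  exact sat_iff_constEval fun _ _ _ _ => by simp

/-! ### The projective unifier -/

namespace Formula

/-- The formula `(¬ □⁻ φ) S (□⁻ φ ∧ x)`: the letter `x` holds at the first state met from here at
which `□⁻ φ` holds, and there is such a state. -/
def atFirstBox (φ : Formula) (x : ℕ) : Formula :=
  since (neg (box φ)) (conj (box φ) (var x))

/-- The substitution that replaces each letter by its value at the first state with `□⁻ φ`, and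
by its value under `v` if there is no such state. For `v x = false` the formula `atFirstBox φ x`
itself does this, as it implies `◇⁻ □⁻ φ`. -/
def projSubst (φ : Formula) (v : ℕ → Bool) (x : ℕ) : Formula :=
  bif v x then imp (diamond (box φ)) (atFirstBox φ x) else atFirstBox φ x

theorem sat_projSubst_of_diamond {V : ℕ → Set ℕ} {φ : Formula} {a : ℕ}
    (h : (diamond (box φ)).Sat V a) (v : ℕ → Bool) (x : ℕ) :
    (projSubst φ v x).Sat V a ↔ (atFirstBox φ x).Sat V a := by
  cases hv : v x <;> simp [projSubst, hv, sat_imp, h]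

theorem sat_projSubst_of_box {V : ℕ → Set ℕ} {φ : Formula} {a : ℕ}
    (h : (box φ).Sat V a) (v : ℕ → Bool) (x : ℕ) :
    (projSubst φ v x).Sat V a ↔ a ∈ V x := by
  rw [sat_projSubst_of_diamond (sat_diamond.2 ⟨a, le_rfl, h⟩), atFirstBox, sat_since_iff_succ]
  simp [Sat, h]

theorem sat_projSubst_of_not_diamond {V : ℕ → Set ℕ} {φ : Formula} {a : ℕ}
    (h : ¬ (diamond (box φ)).Sat V a) (v : ℕ → Bool) (x : ℕ) :
    (projSubst φ v x).Sat V a ↔ v x = true := by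
  have h' : ¬ (atFirstBox φ x).Sat V a := fun ⟨b, hb, hs, _⟩ => h (sat_diamond.2 ⟨b, hb, hs.1⟩)
  cases hv : v x <;> simp [projSubst, hv, sat_imp, h, h']

theorem sat_projSubst_succ {V : ℕ → Set ℕ} {φ : Formula} {a : ℕ} (hbox : ¬ (box φ).Sat V a)
    (h : (diamond (box φ)).Sat V (a + 1)) (v : ℕ → Bool) (x : ℕ) :
    (projSubst φ v x).Sat V a ↔ (projSubst φ v x).Sat V (a + 1) := by
  have h' : (diamond (box φ)).Sat V a := by
    obtain ⟨b, hb, hs⟩ := sat_diamond.1 h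
    exact sat_diamond.2 ⟨b, by omega, hs⟩
  rw [sat_projSubst_of_diamond h, sat_projSubst_of_diamond h', atFirstBox, sat_since_iff_succ]
  simp [Sat, hbox]

theorem isUnifier_projSubst {φ : Formula} {v : ℕ → Bool} (hv : constEval v φ = true) :
    IsUnifier φ (projSubst φ v) := by
  intro V a
  rw [sat_subst]
  by_cases h : (diamond (box φ)).Sat V a
  · obtain ⟨b, hb, hs⟩ := sat_diamond.1 h
    clear h
    -- Go back from the state `b` with `□⁻ φ`, one stuttering step at a time.
    induction hb using Nat.decreasingInduction with
    | self =>
      refine (sat_congr fun x _ c hc => ?_).1 (sat_box.1 hs b le_rfl)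
      exact (sat_projSubst_of_box (sat_box_mono hc hs) v x).symm
    | of_succ c hc ih =>
      by_cases hbox : (box φ).Sat V c
      · refine (sat_congr fun x _ d hd => ?_).1 (sat_box.1 hbox c le_rfl)
        exact (sat_projSubst_of_box (sat_box_mono hd hbox) v x).symm
      · exact (sat_succ_iff fun x _ =>
          sat_projSubst_succ hbox (sat_diamond.2 ⟨b, hc, hs⟩) v x).2 ih
  · refine (sat_iff_constEval fun x _ c hc => ?_).2 hv
    refine sat_projSubst_of_not_diamond (fun h' => h ?_) v x
    obtain ⟨b, hb, hs⟩ := sat_diamond.1 h'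
    exact sat_diamond.2 ⟨b, hc.trans hb, hs⟩

theorem isProjectiveUnifier_projSubst {φ : Formula} {v : ℕ → Bool} (hv : constEval v φ = true) :
    IsProjectiveUnifier φ (projSubst φ v) :=
  ⟨isUnifier_projSubst hv, fun x _ _ _ => sat_imp.2 fun hbox =>
    sat_iff.2 (sat_projSubst_of_box hbox v x).symm⟩

end Formula

theorem IsProjectiveUnifier.congr {φ : Formula} {σ τ : ℕ → Formula}
    (hσ : IsProjectiveUnifier φ σ) (h : ∀ x ∈ φ.letters, τ x = σ x) :
    IsProjectiveUnifier φ τ := by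
  refine ⟨fun V a => ?_, fun x hx => h x hx ▸ hσ.2 x hx⟩
  have h₁ := (sat_subst σ V φ a).1 (hσ.1 V a)
  exact (sat_subst τ V φ a).2 ((sat_congr fun x hx b _ => by simp [h x hx]).1 h₁)

/-! ### Searching for a constant assignment -/

/-- All lists of truth values of a given length. -/
def boolLists : ℕ → List (List Bool)
  | 0 => [[]]
  | n + 1 => (boolLists n).flatMap fun l => [false :: l, true :: l]

theorem mem_boolLists (l : List Bool) : l ∈ boolLists l.length := by
  induction l with
  | nil => simp [boolLists]
  | cons b l ih =>
    simp only [List.length_cons, boolLists, List.mem_flatMap]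
    exact ⟨l, ih, by cases b <;> simp⟩

/-- The assignment given by a list of truth values; letters beyond the list are false. -/
def listVal (l : List Bool) (n : ℕ) : Bool := l.getD n false

namespace Formula

theorem lt_encodeNat_of_mem_letters {φ : Formula} {n : ℕ} (h : n ∈ φ.letters) :
    n < encodeNat φ := by
  induction φ with
  | bot => simp [letters] at h
  | var m =>
    obtain rfl : n = m := by simpa [letters] using h
    rw [encodeNat]; omega
  | neg φ ih =>
    have := ih h
    rw [encodeNat]; omega
  | conj φ ψ ih₁ ih₂ =>
    have h₁ := Nat.left_le_pair (encodeNat φ) (encodeNat ψ)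
    have h₂ := Nat.right_le_pair (encodeNat φ) (encodeNat ψ)
    rw [encodeNat]
    rcases Finset.mem_union.1 h with h | h
    · have := ih₁ h; omega
    · have := ih₂ h; omega
  | since φ ψ ih₁ ih₂ =>
    have h₁ := Nat.left_le_pair (encodeNat φ) (encodeNat ψ)
    have h₂ := Nat.right_le_pair (encodeNat φ) (encodeNat ψ)
    rw [encodeNat]
    rcases Finset.mem_union.1 h with h | h
    · have := ih₁ h; omega
    · have := ih₂ h; omega

/-- The first list of truth values for the letters below the Gödel number of `φ` that makes `φ`
true. If there is none, this is the empty list, which is then of no use. -/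
def searchVal (φ : Formula) : List Bool :=
  ((boolLists (encodeNat φ)).filterMap fun l =>
    bif constEval (listVal l) φ then some l else none).headI

theorem constEval_searchVal {φ : Formula} {v : ℕ → Bool} (hv : constEval v φ = true) :
    constEval (listVal (searchVal φ)) φ = true := by
  set s := (boolLists (encodeNat φ)).filterMap fun l =>
    bif constEval (listVal l) φ then some l else none with hs
  have hmem : ∀ l ∈ s, constEval (listVal l) φ = true := by
    intro l hl
    obtain ⟨l', -, hl'⟩ := List.mem_filterMap.1 hl
    cases hc : constEval (listVal l') φ <;> simp_all
  have hne : (List.range (encodeNat φ)).map v ∈ s := by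
    refine List.mem_filterMap.2
      ⟨_, by simpa using mem_boolLists ((List.range (encodeNat φ)).map v), ?_⟩
    rw [constEval_congr (w := v), hv, cond_true]
    intro n hn
    simp [listVal, lt_encodeNat_of_mem_letters hn]
  change constEval (listVal s.headI) φ = true
  cases hcase : s with
  | nil => simp [hcase] at hne
  | cons l t => exact hmem l (by simp [hcase])

/-- The table of the projective unifier, for the letters below the Gödel number of `φ`. -/
def projTable (φ : Formula) : List (ℕ × Formula) :=
  (List.range (encodeNat φ)).map fun x => (x, projSubst φ (listVal (searchVal φ)) x)

end Formula

theorem lookup_map_pair {α β : Type*} [DecidableEq α] (g : α → β) {l : List α} {x : α}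
    (hx : x ∈ l) : (l.map fun y => (y, g y)).lookup x = some (g x) := by
  induction l with
  | nil => simp at hx
  | cons y l ih =>
    rw [List.map_cons, List.lookup_cons]
    rcases eq_or_ne x y with rfl | hxy
    · simp
    · simp [beq_false_of_ne hxy, ih ((List.mem_cons.1 hx).resolve_left hxy)]

theorem isProjectiveUnifier_tableSubst_projTable {φ : Formula} (h : Unifiable φ) :
    IsProjectiveUnifier φ (tableSubst φ.projTable) := by
  obtain ⟨v, hv⟩ := h.exists_constEval
  refine (isProjectiveUnifier_projSubst (constEval_searchVal hv)).congr fun x hx => ?_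
  rw [tableSubst, projTable,
    lookup_map_pair _ (List.mem_range.2 (lt_encodeNat_of_mem_letters hx)), Option.getD_some]

/-! ### Computability -/

theorem primrec_boolLists : Primrec boolLists := by
  have hstep : Primrec fun L : List (List Bool) => L.flatMap fun l => [false :: l, true :: l] :=
    Primrec.list_flatMap .id (Primrec.list_cons.comp
      (Primrec.list_cons.comp (.const false) .snd)
      (Primrec.list_cons.comp (Primrec.list_cons.comp (.const true) .snd) (.const [])))
  refine (Primrec.nat_rec₁ [[]] (hstep.comp .snd).to₂).of_eq fun n => ?_
  induction n with
  | zero => rfl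
  | succ n ih => simp only [boolLists, ← ih]

namespace Formula

theorem primrec_encodeNat : Primrec encodeNat := Primrec.encode

theorem primrec_of_encodeNat {α : Type*} [Primcodable α] {f : α → Formula}
    (h : Primrec fun a => encodeNat (f a)) : Primrec f :=
  Primrec.encode_iff.1 h

theorem primrec_var : Primrec var :=
  primrec_of_encodeNat <| Primrec.succ.comp <| Primrec.nat_mul.comp (.const 4) .id

theorem primrec_neg : Primrec neg :=
  primrec_of_encodeNat <|
    Primrec.nat_add.comp (Primrec.nat_mul.comp (.const 4) primrec_encodeNat) (.const 2)

theorem primrec_conj : Primrec₂ conj :=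
  primrec_of_encodeNat <| Primrec.nat_add.comp (Primrec.nat_mul.comp (.const 4)
    (Primrec₂.natPair.comp (primrec_encodeNat.comp .fst) (primrec_encodeNat.comp .snd)))
    (.const 3)

theorem primrec_since : Primrec₂ since :=
  primrec_of_encodeNat <| Primrec.nat_add.comp (Primrec.nat_mul.comp (.const 4)
    (Primrec₂.natPair.comp (primrec_encodeNat.comp .fst) (primrec_encodeNat.comp .snd)))
    (.const 4)

theorem primrec_imp : Primrec₂ imp :=
  primrec_neg.comp (primrec_conj.comp .fst (primrec_neg.comp .snd))

theorem primrec_diamond : Primrec diamond :=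
  primrec_since.comp (.const top) .id

theorem primrec_box : Primrec box :=
  primrec_neg.comp (primrec_diamond.comp primrec_neg)

theorem primrec_atFirstBox : Primrec₂ atFirstBox :=
  primrec_since.comp (primrec_neg.comp (primrec_box.comp .fst))
    (primrec_conj.comp (primrec_box.comp .fst) (primrec_var.comp .snd))

/-- One step of the course-of-values recursion that computes `constEval` on Gödel numbers: `t` is
the list of the truth values of the formulas whose Gödel numbers are below `t.length`. -/
def constEvalStep (l t : List Bool) : Bool :=
  let k := t.length - 1
  bif t.length == 0 then false
  else bif k % 4 == 0 then listVal l (k / 4)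
  else bif k % 4 == 1 then !listVal t (k / 4)
  else bif k % 4 == 2 then listVal t (k / 4).unpair.1 && listVal t (k / 4).unpair.2
  else listVal t (k / 4).unpair.2

theorem constEvalStep_eq (l : List Bool) (n : ℕ) :
    constEvalStep l ((List.range n).map fun m => constEval (listVal l) (decodeNat m)) =
      constEval (listVal l) (decodeNat n) := by
  cases n with
  | zero => simp [constEvalStep, decodeNat, constEval]
  | succ k =>
    have h : k / 4 < k + 1 := by omega
    have h₁ : (k / 4).unpair.1 < k + 1 := lt_of_le_of_lt (Nat.unpair_left_le _) h
    have h₂ : (k / 4).unpair.2 < k + 1 := lt_of_le_of_lt (Nat.unpair_right_le _) h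
    have ht : ∀ m < k + 1, listVal ((List.range (k + 1)).map fun m =>
        constEval (listVal l) (decodeNat m)) m = constEval (listVal l) (decodeNat m) := by
      intro m hm
      simp [listVal, hm]
    have hk : k % 4 = 0 ∨ k % 4 = 1 ∨ k % 4 = 2 ∨ k % 4 = 3 := by omega
    simp only [constEvalStep, ht _ h, ht _ h₁, ht _ h₂, List.length_map, List.length_range,
      Nat.add_sub_cancel]
    rw [decodeNat]
    rcases hk with hk | hk | hk | hk <;> simp [hk, constEval]

theorem primrec_listVal : Primrec₂ listVal := Primrec.list_getD false

theorem primrec_constEvalStep : Primrec₂ constEvalStep := by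
  have hlen : Primrec fun p : List Bool × List Bool => p.2.length :=
    Primrec.list_length.comp .snd
  have hk : Primrec fun p : List Bool × List Bool => p.2.length - 1 :=
    Primrec.nat_sub.comp hlen (.const 1)
  have hmod : Primrec fun p : List Bool × List Bool => (p.2.length - 1) % 4 :=
    Primrec.nat_mod.comp hk (.const 4)
  have hdiv : Primrec fun p : List Bool × List Bool => (p.2.length - 1) / 4 :=
    Primrec.nat_div.comp hk (.const 4)
  have hu := Primrec.unpair.comp hdiv
  have h₁ := primrec_listVal.comp .snd (Primrec.fst.comp hu)
  have h₂ := primrec_listVal.comp .snd (Primrec.snd.comp hu)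
  exact Primrec.cond (Primrec.beq.comp hlen (.const 0)) (.const false) <|
    Primrec.cond (Primrec.beq.comp hmod (.const 0)) (primrec_listVal.comp .fst hdiv) <|
    Primrec.cond (Primrec.beq.comp hmod (.const 1))
      (Primrec.not.comp (primrec_listVal.comp .snd hdiv)) <|
    Primrec.cond (Primrec.beq.comp hmod (.const 2)) (Primrec.and.comp h₁ h₂) h₂

theorem primrec_constEval : Primrec₂ fun (l : List Bool) (φ : Formula) =>
    constEval (listVal l) φ := by
  have h : Primrec₂ fun (l : List Bool) (n : ℕ) => constEval (listVal l) (decodeNat n) :=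
    Primrec.nat_strong_rec _ (Primrec.option_some.comp₂ primrec_constEvalStep) fun l n =>
      congrArg some (constEvalStep_eq l n)
  exact (h.comp .fst (primrec_encodeNat.comp .snd)).of_eq fun p => by rw [decodeNat_encodeNat]

theorem primrec_searchVal : Primrec searchVal :=
  Primrec.list_headI.comp <|
    Primrec.listFilterMap (primrec_boolLists.comp primrec_encodeNat) <|
      Primrec.cond (primrec_constEval.comp .snd .fst) (Primrec.option_some.comp .snd)
        (.const none)

theorem primrec_projTable : Primrec projTable :=
  Primrec.list_map (Primrec.list_range.comp primrec_encodeNat) <|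
    Primrec.pair .snd <|
      Primrec.cond (primrec_listVal.comp (primrec_searchVal.comp .fst) .snd)
        (primrec_imp.comp (primrec_diamond.comp (primrec_box.comp .fst))
          (primrec_atFirstBox.comp .fst .snd))
        (primrec_atFirstBox.comp .fst .snd)

end Formula

end PastLTL

theorem theorem1 :
    (∀ φ : PastLTL.Formula, PastLTL.Unifiable φ → PastLTL.Projective φ) ∧
    ∃ f : PastLTL.Formula → List (ℕ × PastLTL.Formula), Computable f ∧
      ∀ φ : PastLTL.Formula, PastLTL.Unifiable φ →
        PastLTL.IsProjectiveUnifier φ (PastLTL.tableSubst (f φ)) :=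
  ⟨fun _ h => ⟨_, PastLTL.isProjectiveUnifier_tableSubst_projTable h⟩,
    PastLTL.Formula.projTable, PastLTL.Formula.primrec_projTable.to_comp,
    fun _ h => PastLTL.isProjectiveUnifier_tableSubst_projTable h⟩
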